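/- Let $I=[\xi,\eta]$ with $\xi<\eta$, and let $a:I\to\mathbb{R}$ satisfy $a\ge a_0>0$ on $I$. Let $G\subset\mathbb{C}$ be an open neighbourhood of $I$ to which $\sqrt a$ extends as a bounded analytic function (again written $\sqrt a$), so that also $a$ is analytic on $G$. Define two sequences of functions by $(S_0^{\pm})'=\pm i\sqrt a$ and $$(S_n)'=-\frac{1}{2S_0'}\Big(\sum_{j=1}^{n-1}S_j'S_{n-j}'+S_{n-1}''\Big)\quad(n\ge 1),\qquad S_n^{\pm}(x)=\int_\xi^x (S_n^{\pm})'(\tau)\,d\tau\quad (n\ge 0),$$ and put $M=\|S_0'\|_{L^\infty(G)}$. For $\varepsilon>0$ and $\varphi_0,\varphi_1\in\mathbb{C}$ let $\varphi$ be the solution of $$\varepsilon^2\varphi''+a\varphi=0 \text{ on } I,\qquad \varphi(\xi)=\varphi_0,\quad \varepsilon\varphi'(\xi)=\varphi_1 ,$$ and for $N\in\mathbb{N}_0$ let $$\varphi_N^{WKB}=\alpha_{N,\varepsilon}\exp\Big(\sum_{n=0}^N\varepsilon^{n-1}S_n^-\Big)+\beta_{N,\varepsilon}\exp\Big(\sum_{n=0}^N\varepsilon^{n-1}S_n^+\Big),$$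 $$\alpha_{N,\varepsilon}=\frac{\varphi_0\sum_{n=0}^N\varepsilon^n(S_n^+)'(\xi)-\varphi_1}{\sum_{n=0}^N\varepsilon^n\big((S_n^+)'(\xi)-(S_n^-)'(\xi)\big)},\qquad \beta_{N,\varepsilon}=\frac{\varphi_1-\varphi_0\sum_{n=0}^N\varepsilon^n(S_n^-)'(\xi)}{\sum_{n=0}^N\varepsilon^n\big((S_n^+)'(\xi)-(S_n^-)'(\xi)\big)} .$$ (With $0^0=1$.) There exist constants $K_1,K_2>0$, depending only on $I$, $G$ and $S_0'$, such that for both sequences $$\|S_n\|_{L^\infty(I)}\le(\eta-\xi)MK_2^nn^n\ (n\ge 0),\qquad \|S_n^{(k)}\|_{L^\infty(I)}\le M(k-1)!\,K_1^{k-1}K_2^nn^n\ (n\ge 0,\ k\ge 1).$$ For all such constants $K_1,K_2$ there exist a constant $C>0$, independent of $N$, $\varepsilon$, $\varphi_0$, $\varphi_1$, and numbers $\varepsilon_0(N)\in(0,1)$, independent of $\varphi_0,\varphi_1$ and satisfying $\varepsilon_0(N)\ge c/(N+1)$ with some $c>0$ independent of $N$, such that for all $N\ge 0$ and $\varepsilon\in(0,\varepsilon_0(N)]$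 the denominator of $\alpha_{N,\varepsilon}$ and $\beta_{N,\varepsilon}$ does not vanish and $$\|\varphi-\varphi_N^{WKB}\|_{L^\infty(I)}\le CM^2\Big(|\varphi_0|M\sum_{n=0}^N\varepsilon^nK_2^nn^n+|\varphi_1|\Big)\exp\Big((\eta-\xi)M\sum_{n=0}^{\lfloor N/2\rfloor}\varepsilon^{2n}K_2^{2n+1}(2n+1)^{2n+1}\Big)$$ $$\qquad\cdot\Big(2\varepsilon^NK_2^{N+1}(N+1)^{N+1}+\sum_{n=2}^N\varepsilon^{N+n-1}K_2^{N+n}\sum_{k=2}^{N+n}k^k(N+n-k)^{N+n-k}\Big).$$ In particular, for fixed $\varphi_0,\varphi_1$ and each fixed $N$, $\|\varphi-\varphi_N^{WKB}\|_{L^\infty(I)}=\mathcal{O}(\varepsilon^N)$ as $\varepsilon\to0$. -/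

import Mathlib

open MeasureTheory
open scoped ENNReal

namespace WKB

noncomputable section

/-- The `L^∞` norm over a set `s` (essential supremum with respect to Lebesgue measure),
as an extended nonnegative real. -/
def LInf {X : Type*} [MeasureSpace X] (s : Set X) (f : X → ℂ) : ℝ≥0∞ :=
  eLpNorm f ∞ (volume.restrict s)

/-- `dS s₀ n` is the function `S_n'` of the WKB recursion started at `S_0' = s₀`, on the complex
domain where `s₀` is analytic and nonzero. On the real interval the complex derivative of an
analytic function is its real derivative. -/
def dS (s₀ : ℂ → ℂ) : ℕ → ℂ → ℂ
  | 0 => s₀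
  | n + 1 => fun z =>
      -(1 / (2 * s₀ z)) *
        ((∑ j : Fin n, dS s₀ (j + 1) z * dS s₀ (n - j) z) + deriv (dS s₀ n) z)
termination_by n => n
decreasing_by all_goals omega

theorem dS_zero (s₀ : ℂ → ℂ) : dS s₀ 0 = s₀ := by
  rw [dS]

/-- The recursion in its usual form; for `n = 1` the sum is empty. -/
theorem dS_recursion (s₀ : ℂ → ℂ) (n : ℕ) (hn : 1 ≤ n) (z : ℂ) :
    dS s₀ n z = -(1 / (2 * s₀ z)) *
      ((∑ j ∈ Finset.Ico 1 n, dS s₀ j z * dS s₀ (n - j) z) + deriv (dS s₀ (n - 1)) z) := by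
  obtain ⟨m, rfl⟩ : ∃ m, n = m + 1 := ⟨n - 1, by omega⟩
  rw [dS, Finset.sum_Ico_eq_sum_range, Finset.sum_range]
  simp only [Nat.add_sub_cancel]
  congr 2
  refine Finset.sum_congr rfl fun j _ => ?_
  rw [Nat.add_comm 1 (j : ℕ), Nat.add_sub_add_right]

/-- `S_n(x) = ∫_ξ^x S_n'(τ) dτ`. -/
def S (s₀ : ℂ → ℂ) (ξ : ℝ) (n : ℕ) (x : ℝ) : ℂ :=
  ∫ τ in ξ..x, dS s₀ n (τ : ℂ)

/-- `∑_{n=0}^N εⁿ S_n'(x)`. -/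
def dSum (s₀ : ℂ → ℂ) (N : ℕ) (ε x : ℝ) : ℂ :=
  ∑ n ∈ Finset.range (N + 1), (ε : ℂ) ^ n * dS s₀ n (x : ℂ)

/-- `exp(∑_{n=0}^N ε^(n-1) S_n(x))`. -/
def expSum (s₀ : ℂ → ℂ) (ξ : ℝ) (N : ℕ) (ε x : ℝ) : ℂ :=
  Complex.exp (∑ n ∈ Finset.range (N + 1), (ε : ℂ) ^ ((n : ℤ) - 1) * S s₀ ξ n x)

/-- `(S_0^+)' = i √a`, where `σ` is the analytic extension of `√a`. -/
def sPlus (σ : ℂ → ℂ) : ℂ → ℂ := fun z => Complex.I * σ z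

/-- `(S_0^-)' = - i √a`, where `σ` is the analytic extension of `√a`. -/
def sMinus (σ : ℂ → ℂ) : ℂ → ℂ := fun z => -Complex.I * σ z

/-- The common denominator of the two coefficients,
`∑_{n=0}^N εⁿ ((S_n^+)'(ξ) - (S_n^-)'(ξ))`. -/
def denom (σ : ℂ → ℂ) (ξ : ℝ) (N : ℕ) (ε : ℝ) : ℂ :=
  ∑ n ∈ Finset.range (N + 1),
    (ε : ℂ) ^ n * (dS (sPlus σ) n (ξ : ℂ) - dS (sMinus σ) n (ξ : ℂ))

/-- The coefficient `α_{N,ε}`. -/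
def alpha (σ : ℂ → ℂ) (ξ : ℝ) (N : ℕ) (ε : ℝ) (φ₀ φ₁ : ℂ) : ℂ :=
  (φ₀ * dSum (sPlus σ) N ε ξ - φ₁) / denom σ ξ N ε

/-- The coefficient `β_{N,ε}`. -/
def beta (σ : ℂ → ℂ) (ξ : ℝ) (N : ℕ) (ε : ℝ) (φ₀ φ₁ : ℂ) : ℂ :=
  (φ₁ - φ₀ * dSum (sMinus σ) N ε ξ) / denom σ ξ N ε

/-- The truncated WKB approximation `φ_N^WKB`. -/
def approx (σ : ℂ → ℂ) (ξ : ℝ) (N : ℕ) (ε : ℝ) (φ₀ φ₁ : ℂ) (x : ℝ) : ℂ :=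
  alpha σ ξ N ε φ₀ φ₁ * expSum (sMinus σ) ξ N ε x +
    beta σ ξ N ε φ₀ φ₁ * expSum (sPlus σ) ξ N ε x

/-- `φ` is a (classical) solution on `[ξ, η]` of
`ε² φ'' + a φ = 0`, `φ(ξ) = φ₀`, `ε φ'(ξ) = φ₁`. -/
def IsSolution (a : ℝ → ℝ) (ξ η ε : ℝ) (φ₀ φ₁ : ℂ) (φ : ℝ → ℂ) : Prop :=
  ∃ dφ ddφ : ℝ → ℂ,
    (∀ x ∈ Set.Icc ξ η, HasDerivWithinAt φ (dφ x) (Set.Icc ξ η) x) ∧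
    (∀ x ∈ Set.Icc ξ η, HasDerivWithinAt dφ (ddφ x) (Set.Icc ξ η) x) ∧
    (∀ x ∈ Set.Icc ξ η, (ε : ℂ) ^ 2 * ddφ x + (a x : ℂ) * φ x = 0) ∧
    φ ξ = φ₀ ∧ (ε : ℂ) * dφ ξ = φ₁

/-- The estimates on `S_n` and on `S_n^{(k)}`, `k ≥ 1`, over `I = [ξ, η]`, with constants
`K₁, K₂` and `M = ‖S_0'‖_{L^∞(G)}`, for the sequence started at `s₀`. Here `0 ^ 0 = 1`. -/
def Estimates (s₀ : ℂ → ℂ) (ξ η M K₁ K₂ : ℝ) : Prop :=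
  (∀ n : ℕ, LInf (Set.Icc ξ η) (S s₀ ξ n) ≤
    ENNReal.ofReal ((η - ξ) * M * K₂ ^ n * (n : ℝ) ^ n)) ∧
  (∀ n k : ℕ, 1 ≤ k →
    LInf (Set.Icc ξ η) (fun x : ℝ => iteratedDeriv (k - 1) (dS s₀ n) (x : ℂ)) ≤
      ENNReal.ofReal
        (M * ((k - 1).factorial : ℝ) * K₁ ^ (k - 1) * K₂ ^ n * (n : ℝ) ^ n))

/-- `K₁, K₂` are positive constants for which the estimates hold for both sequences
`(S_n^-)` and `(S_n^+)`. -/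
def AdmissibleConstants (σ : ℂ → ℂ) (ξ η M K₁ K₂ : ℝ) : Prop :=
  0 < K₁ ∧ 0 < K₂ ∧
    Estimates (sMinus σ) ξ η M K₁ K₂ ∧ Estimates (sPlus σ) ξ η M K₁ K₂

/-- The right-hand side of the error estimate; `L = η - ξ`, `M = ‖S_0'‖_{L^∞(G)}`,
`p = |φ₀|`, `q = |φ₁|`. -/
def errorBound (C L M K₂ : ℝ) (N : ℕ) (ε p q : ℝ) : ℝ :=
  C * M ^ 2 *
    (p * M * (∑ n ∈ Finset.range (N + 1), ε ^ n * K₂ ^ n * (n : ℝ) ^ n) + q) *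
    Real.exp (L * M * ∑ n ∈ Finset.range (N / 2 + 1),
      ε ^ (2 * n) * K₂ ^ (2 * n + 1) * ((2 * n + 1 : ℕ) : ℝ) ^ (2 * n + 1)) *
    (2 * ε ^ N * K₂ ^ (N + 1) * ((N + 1 : ℕ) : ℝ) ^ (N + 1) +
      ∑ n ∈ Finset.Icc 2 N, ε ^ (N + n - 1) * K₂ ^ (N + n) *
        ∑ k ∈ Finset.Icc 2 (N + n),
          (k : ℝ) ^ k * ((N + n - k : ℕ) : ℝ) ^ (N + n - k))

end

end WKB

namespace WKB

/-! The constants come from Cauchy estimates. At depth `t` inside a complex neighbourhood of the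
interval where `|S_0'|` is bounded above and away from zero, `S_n'` is of size `(K n / t)^n`: the
derivative in the recursion is estimated on a circle of radius `t / n`, and the convolution is
absorbed by `∑ j^j (n-j)^(n-j) ≤ n^n` (`norm_dS_le_of_thickening`).

For the error, each exponential `w` in the approximation has logarithmic derivative `u / ε`, where
`u = ∑ ε^n S_n'`, so applying `ε² ∂² + a` to it gives `(u² + ε u' + a) w`. The recursion says
exactly that all orders of `u² + ε u' + a` up to `ε^N` cancel; the order `N + 1` and the tail of the
truncated square remain (`sq_sum_add_sum_sub_sq`, `norm_residual_le`). The exponentials are bounded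
uniformly in `N` and `ε` as long as `ε K₂ (N + 1)` is small, because `S_0` is imaginary on the
interval and the other terms are dominated by a geometric series. Under the same kind of condition
the denominator stays away from zero, which controls the coefficients.

These coefficients match the initial data exactly, so the error solves the oscillator equation with
zero data and a right-hand side of order `ε^(N+1)`. An energy estimate uniform in `ε`
(`norm_le_of_oscillator`) loses a single power of `ε`. -/

/-! ### Combinatorics of the sequence `n^n`. -/

theorem le_choose {n j : ℕ} (hj : 1 ≤ j) (hjn : j < n) : n ≤ n.choose j := by
  induction n generalizing j with
  | zero => omega
  | succ n ih =>
    obtain ⟨i, rfl⟩ : ∃ i, j = i + 1 := ⟨j - 1, by omega⟩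
    rw [Nat.choose_succ_succ']
    rcases Nat.lt_or_ge (i + 1) n with h | h
    · have h1 := ih (j := i + 1) (by omega) h
      have h2 : 0 < n.choose i := Nat.choose_pos (by omega)
      omega
    · obtain rfl : n = i + 1 := by omega
      simp

/-- A single term of the binomial expansion of `(j + (n - j))^n` is at most `n^n`, and its binomial
coefficient is at least `n`. -/
theorem pow_self_mul_pow_self_le {n j : ℕ} (hj : 1 ≤ j) (hjn : j < n) :
    j ^ j * (n - j) ^ (n - j) ≤ n ^ (n - 1) := by
  have h1 : n.choose j * (j ^ j * (n - j) ^ (n - j)) ≤ n ^ n := by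
    have h := add_pow j (n - j) n
    rw [Nat.add_sub_cancel' hjn.le] at h
    rw [h, mul_comm]
    exact Finset.single_le_sum (f := fun m => j ^ m * (n - j) ^ (n - m) * n.choose m)
      (fun _ _ => Nat.zero_le _) (Finset.mem_range.2 (by omega))
  have h2 : n * (j ^ j * (n - j) ^ (n - j)) ≤ n * n ^ (n - 1) := by
    rw [← pow_succ', Nat.sub_add_cancel (by omega)]
    exact (Nat.mul_le_mul_right _ (le_choose hj hjn)).trans h1
  exact Nat.le_of_mul_le_mul_left h2 (by omega)

theorem sum_pow_self_mul_pow_self_le {n : ℕ} (hn : 1 ≤ n) :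
    ∑ j ∈ Finset.Ico 1 n, (j : ℝ) ^ j * ((n - j : ℕ) : ℝ) ^ (n - j) ≤ (n : ℝ) ^ n := by
  have h : ∑ j ∈ Finset.Ico 1 n, j ^ j * (n - j) ^ (n - j) ≤ n ^ n := by
    calc _ ≤ ∑ j ∈ Finset.Ico 1 n, n ^ (n - 1) := Finset.sum_le_sum fun j hj => by
            rw [Finset.mem_Ico] at hj
            exact pow_self_mul_pow_self_le hj.1 hj.2
      _ = (n - 1) * n ^ (n - 1) := by simp
      _ ≤ n * n ^ (n - 1) := Nat.mul_le_mul_right _ (by omega)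
      _ = n ^ n := by rw [← pow_succ', Nat.sub_add_cancel hn]
  exact_mod_cast h

/-! ### Growth of `S_n'` in a complex neighbourhood. -/

theorem differentiableOn_dS {s₀ : ℂ → ℂ} {U : Set ℂ} (hU : IsOpen U)
    (hs : DifferentiableOn ℂ s₀ U) (h0 : ∀ z ∈ U, s₀ z ≠ 0) (n : ℕ) :
    DifferentiableOn ℂ (dS s₀ n) U := by
  induction n using Nat.strong_induction_on with
  | _ n ih =>
    rcases Nat.eq_zero_or_pos n with rfl | hn
    · rwa [dS_zero]
    · have h1 : DifferentiableOn ℂ (fun z => -(1 / (2 * s₀ z)) *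
          ((∑ j ∈ Finset.Ico 1 n, dS s₀ j z * dS s₀ (n - j) z) + deriv (dS s₀ (n - 1)) z)) U := by
        refine DifferentiableOn.mul ?_ (DifferentiableOn.add ?_ ?_)
        · exact ((differentiableOn_const _).div (hs.const_mul 2) fun z hz =>
            mul_ne_zero two_ne_zero (h0 z hz)).neg
        · refine DifferentiableOn.fun_sum fun j hj => ?_
          rw [Finset.mem_Ico] at hj
          exact (ih j hj.2).mul (ih (n - j) (by omega))
        · exact (ih (n - 1) (by omega)).deriv hU
      exact h1.congr fun z _ => dS_recursion s₀ n hn z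

/-- Strong induction over all depths `t` at once, since the derivative of `S_{n-1}'` costs a strip
of width `t / n`. The convolution and the derivative each contribute half of the bound. -/
theorem norm_dS_le_of_thickening {s₀ : ℂ → ℂ} {T : Set ℂ} {δ m M K : ℝ} (hm : 0 < m)
    (hs : DifferentiableOn ℂ s₀ (Metric.thickening δ T))
    (hlow : ∀ z ∈ Metric.thickening δ T, m ≤ ‖s₀ z‖)
    (hup : ∀ z ∈ Metric.thickening δ T, ‖s₀ z‖ ≤ M)
    (hK : 1 ≤ K * m) (hKM : M ≤ m * (K * m)) {n : ℕ} (hn : 1 ≤ n) {t : ℝ} (ht : 0 < t)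
    {z : ℂ} (hz : z ∈ Metric.thickening (δ - t) T) :
    ‖dS s₀ n z‖ ≤ m * K ^ n * (n : ℝ) ^ n / t ^ n := by
  have hK0 : 0 < K := by
    by_contra! h
    nlinarith
  have hd := differentiableOn_dS Metric.isOpen_thickening hs
    (fun z hz h => by have := hlow z hz; rw [h, norm_zero] at this; linarith)
  induction n using Nat.strong_induction_on generalizing t z with
  | _ n ih =>
    have hn0 : (0 : ℝ) < n := by exact_mod_cast hn
    have hzδ : z ∈ Metric.thickening δ T := Metric.thickening_mono (by linarith) _ hz
    have hw : ∀ w, dist w z ≤ t / n → w ∈ Metric.thickening (δ - (t - t / n)) T := by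
      intro w hw
      obtain ⟨x, hx, hzx⟩ := Metric.mem_thickening_iff.1 hz
      exact Metric.mem_thickening_iff.2 ⟨x, hx, by linarith [dist_triangle w z x]⟩
    have htn : t / n ≤ t := div_le_self ht.le (by exact_mod_cast hn)
    have hball : Metric.closedBall z (t / n) ⊆ Metric.thickening δ T := fun w hw' =>
      Metric.thickening_mono (by linarith) _ (hw w hw')
    have hderiv : ‖deriv (dS s₀ (n - 1)) z‖ ≤ m * (K * m) * K ^ (n - 1) * (n : ℝ) ^ n / t ^ n := by
      have key : ∀ w ∈ Metric.sphere z (t / n),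
          ‖dS s₀ (n - 1) w‖ ≤ m * (K * m) * K ^ (n - 1) * (n / t) ^ (n - 1) := by
        intro w hw'
        rcases Nat.lt_or_ge 1 n with h | h
        · have hn1 : ((n - 1 : ℕ) : ℝ) = n - 1 := by push_cast [Nat.cast_sub hn]; ring
          have hn2 : (0 : ℝ) < n - 1 := by
            have : (1 : ℝ) < n := by exact_mod_cast h
            linarith
          have ht' : t - t / n = t * (n - 1) / n := by field_simp
          have h2 := ih (n - 1) (by omega) (by omega) (t := t - t / n)
            (by rw [ht']; positivity) (hw w (le_of_eq hw'))
          refine h2.trans ?_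
          rw [mul_div_assoc, ← div_pow, hn1, ht']
          -- The radius `t / n` is chosen for this identity: the remaining depth is `t (n-1) / n`,
          -- so the factor `n - 1` in the inductive bound turns into `n` with no further loss.
          have : ((n : ℝ) - 1) / (t * (n - 1) / n) = n / t := by field_simp
          rw [this]
          have : m ≤ m * (K * m) := le_mul_of_one_le_right hm.le hK
          gcongr
        -- The bound for `S_0'` is `M` rather than `m`; `hKM` pays for the difference.
        · obtain rfl : n = 1 := by omega
          simp only [Nat.sub_self, dS_zero, pow_zero, mul_one]
          exact (hup w (hball (Metric.sphere_subset_closedBall hw'))).trans hKM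
      have h3 := Complex.norm_deriv_le_of_forall_mem_sphere_norm_le (by positivity)
        ((hd (n - 1)).diffContOnCl_ball hball) key
      refine h3.trans (le_of_eq ?_)
      obtain ⟨k, rfl⟩ : ∃ k, n = k + 1 := ⟨n - 1, by omega⟩
      rw [Nat.add_sub_cancel, div_pow]
      field_simp
      ring
    have hsum : ‖∑ j ∈ Finset.Ico 1 n, dS s₀ j z * dS s₀ (n - j) z‖ ≤
        m * m * K ^ n * (n : ℝ) ^ n / t ^ n := by
      calc _ ≤ ∑ j ∈ Finset.Ico 1 n, ‖dS s₀ j z * dS s₀ (n - j) z‖ := norm_sum_le _ _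
        _ ≤ ∑ j ∈ Finset.Ico 1 n, m * m * K ^ n / t ^ n *
            ((j : ℝ) ^ j * ((n - j : ℕ) : ℝ) ^ (n - j)) := Finset.sum_le_sum fun j hj => by
              rw [Finset.mem_Ico] at hj
              rw [norm_mul]
              calc _ ≤ (m * K ^ j * (j : ℝ) ^ j / t ^ j) *
                    (m * K ^ (n - j) * ((n - j : ℕ) : ℝ) ^ (n - j) / t ^ (n - j)) :=
                    mul_le_mul (ih j hj.2 hj.1 ht hz) (ih (n - j) (by omega) (by omega) ht hz)
                      (norm_nonneg _) (by positivity)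
                _ = _ := by
                    rw [← pow_mul_pow_sub K hj.2.le, ← pow_mul_pow_sub t hj.2.le]
                    field_simp
        _ ≤ m * m * K ^ n / t ^ n * (n : ℝ) ^ n := by
            rw [← Finset.mul_sum]
            gcongr
            exact sum_pow_self_mul_pow_self_le hn
        _ = _ := by ring
    rw [dS_recursion s₀ n hn z, norm_mul, norm_neg, norm_div, norm_one, norm_mul, Complex.norm_ofNat]
    calc _ ≤ 1 / (2 * m) * (m * m * K ^ n * (n : ℝ) ^ n / t ^ n +
          m * (K * m) * K ^ (n - 1) * (n : ℝ) ^ n / t ^ n) := by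
          have := hlow z hzδ
          gcongr
          exact (norm_add_le _ _).trans (add_le_add hsum hderiv)
      _ = _ := by
          obtain ⟨k, rfl⟩ : ∃ k, n = k + 1 := ⟨n - 1, by omega⟩
          rw [Nat.add_sub_cancel, pow_succ K]
          field_simp
          ring

/-! ### Essential suprema versus pointwise bounds. -/

theorem LInf_Icc_le {ξ η B : ℝ} {f : ℝ → ℂ} (h : ∀ x ∈ Set.Icc ξ η, ‖f x‖ ≤ B) :
    LInf (Set.Icc ξ η) f ≤ ENNReal.ofReal B := by
  rw [LInf, eLpNorm_exponent_top]
  exact eLpNormEssSup_le_of_ae_bound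
    ((ae_restrict_iff' measurableSet_Icc).2 (Filter.Eventually.of_forall h))

theorem norm_le_of_LInf_Icc_le {ξ η B : ℝ} (hξη : ξ < η) (hB : 0 ≤ B) {f : ℝ → ℂ}
    (hf : ContinuousOn f (Set.Icc ξ η))
    (h : LInf (Set.Icc ξ η) f ≤ ENNReal.ofReal B) {x : ℝ} (hx : x ∈ Set.Icc ξ η) :
    ‖f x‖ ≤ B := by
  rw [LInf, eLpNorm_exponent_top] at h
  have h1 : ∀ᵐ x ∂(volume.restrict (Set.Icc ξ η)), ‖f x‖ ≤ B := by
    filter_upwards [enorm_ae_le_eLpNormEssSup f (volume.restrict (Set.Icc ξ η))] with x hx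
    have := hx.trans h
    rwa [← ofReal_norm, ENNReal.ofReal_le_ofReal_iff hB] at this
  -- This turns an almost everywhere inequality into an almost everywhere equality of continuous
  -- functions, which then holds everywhere on the interval.
  have h2 : (fun x => max ‖f x‖ B) =ᵐ[volume.restrict (Set.Icc ξ η)] fun _ => B := by
    filter_upwards [h1] with x hx
    exact max_eq_right hx
  have h3 := Measure.eqOn_Icc_of_ae_eq volume hξη.ne h2 (hf.norm.sup continuousOn_const)
    continuousOn_const hx
  exact max_eq_right_iff.1 h3

/-- A point exceeding the essential supremum would, by continuity, give a nonempty open set of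
measure zero. Boundedness keeps the norm finite, so that `toReal` is faithful. -/
theorem norm_le_toReal_LInf {G : Set ℂ} (hG : IsOpen G) {f : ℂ → ℂ} (hf : ContinuousOn f G)
    (hb : Bornology.IsBounded (f '' G)) {z : ℂ} (hz : z ∈ G) : ‖f z‖ ≤ (LInf G f).toReal := by
  obtain ⟨B, hB⟩ := hb.exists_norm_le
  have hfin : LInf G f ≤ ENNReal.ofReal B := by
    rw [LInf, eLpNorm_exponent_top]
    exact eLpNormEssSup_le_of_ae_bound ((ae_restrict_iff' hG.measurableSet).2
      (Filter.Eventually.of_forall fun w hw => hB _ ⟨w, hw, rfl⟩))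
  have hne : LInf G f ≠ ∞ := ne_top_of_le_ne_top ENNReal.ofReal_ne_top hfin
  by_contra! hlt
  have hopen : IsOpen (G ∩ (fun w => ‖f w‖) ⁻¹' Set.Ioi (LInf G f).toReal) :=
    hf.norm.isOpen_inter_preimage hG isOpen_Ioi
  have hzero : volume (G ∩ (fun w => ‖f w‖) ⁻¹' Set.Ioi (LInf G f).toReal) = 0 := by
    have h1 := enorm_ae_le_eLpNormEssSup f (volume.restrict G)
    rw [ae_restrict_iff' hG.measurableSet] at h1
    refine measure_mono_null ?_ (ae_iff.1 h1)
    rintro w ⟨hwG, hw⟩ hcon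
    have h2 : ‖f w‖ₑ ≤ LInf G f := by
      rw [LInf, eLpNorm_exponent_top]; exact hcon hwG
    rw [← ofReal_norm] at h2
    exact absurd ((ENNReal.ofReal_le_iff_le_toReal hne).1 h2) (not_le.2 (Set.mem_Ioi.1 hw))
  have hemp := (hopen.measure_eq_zero_iff volume).1 hzero
  exact (Set.eq_empty_iff_forall_notMem.1 hemp z) ⟨hz, hlt⟩

/-! ### Existence of the constants. -/

theorem estimates_of_thickening {s₀ : ℂ → ℂ} {ξ η δ m M K : ℝ} (hξη : ξ < η) (hδ : 0 < δ)
    (hm : 0 < m)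
    (hs : DifferentiableOn ℂ s₀ (Metric.thickening δ (Complex.ofReal '' Set.Icc ξ η)))
    (hlow : ∀ z ∈ Metric.thickening δ (Complex.ofReal '' Set.Icc ξ η), m ≤ ‖s₀ z‖)
    (hup : ∀ z ∈ Metric.thickening δ (Complex.ofReal '' Set.Icc ξ η), ‖s₀ z‖ ≤ M)
    (hK : 1 ≤ K * m) (hKM : M ≤ m * (K * m)) :
    Estimates s₀ ξ η M (4 / δ) (2 * K / δ) := by
  have hK0 : 0 < K := by
    by_contra! h
    nlinarith
  have hI : ∀ x ∈ Set.Icc ξ η, ∀ r, 0 < r →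
      (x : ℂ) ∈ Metric.thickening r (Complex.ofReal '' Set.Icc ξ η) := fun x hx r hr =>
    Metric.self_subset_thickening hr _ ⟨x, hx, rfl⟩
  have hmM : m ≤ M := (hlow _ (hI ξ ⟨le_rfl, hξη.le⟩ δ hδ)).trans
    (hup _ (hI ξ ⟨le_rfl, hξη.le⟩ δ hδ))
  have hM : 0 < M := hm.trans_le hmM
  have hd := differentiableOn_dS Metric.isOpen_thickening hs
    (fun z hz h => by have := hlow z hz; rw [h, norm_zero] at this; linarith)
  have hmain : ∀ n : ℕ, ∀ z ∈ Metric.thickening (δ / 2) (Complex.ofReal '' Set.Icc ξ η),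
      ‖dS s₀ n z‖ ≤ M * (2 * K / δ) ^ n * (n : ℝ) ^ n := by
    intro n z hz
    rcases Nat.eq_zero_or_pos n with rfl | hn
    · simpa [dS_zero] using hup z (Metric.thickening_mono (by linarith) _ hz)
    · have h := norm_dS_le_of_thickening hm hs hlow hup hK hKM hn (t := δ / 2) (by positivity)
        (z := z) (by rwa [sub_half])
      refine h.trans ?_
      have : m * K ^ n * (n : ℝ) ^ n / (δ / 2) ^ n = m * (2 * K / δ) ^ n * (n : ℝ) ^ n := by
        rw [div_pow, div_pow, mul_pow]
        field_simp
      rw [this]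
      gcongr
  refine ⟨fun n => LInf_Icc_le fun x hx => ?_, fun n k hk => LInf_Icc_le fun x hx => ?_⟩
  · have h := intervalIntegral.norm_integral_le_of_norm_le_const (a := ξ) (b := x)
      (f := fun τ : ℝ => dS s₀ n (τ : ℂ)) (C := M * (2 * K / δ) ^ n * (n : ℝ) ^ n)
      (fun τ hτ => by
        rw [Set.uIoc_of_le hx.1] at hτ
        exact hmain n _ (hI τ ⟨hτ.1.le, hτ.2.trans hx.2⟩ _ (by positivity)))
    rw [S]
    refine h.trans ?_
    rw [abs_of_nonneg (by linarith [hx.1])]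
    calc _ ≤ M * (2 * K / δ) ^ n * (n : ℝ) ^ n * (η - ξ) := by
          gcongr
          exact hx.2
      _ = _ := by ring
  -- Half of the thickening is spent on bounding `S_n'`; circles of radius `δ / 4` fit in the other
  -- half and produce `K₁ = 4 / δ`.
  · have hball : Metric.closedBall (x : ℂ) (δ / 4) ⊆
        Metric.thickening (δ / 2) (Complex.ofReal '' Set.Icc ξ η) := fun w hw =>
      Metric.mem_thickening_iff.2 ⟨x, ⟨x, hx, rfl⟩, by
        have := Metric.mem_closedBall.1 hw
        linarith⟩
    have h := Complex.norm_iteratedDeriv_le_of_forall_mem_sphere_norm_le (k - 1)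
      (by positivity : 0 < δ / 4)
      ((hd n).diffContOnCl_ball (hball.trans (Metric.thickening_mono (by linarith) _)))
      (fun w hw => hmain n w (hball (Metric.sphere_subset_closedBall hw)))
    refine h.trans (le_of_eq ?_)
    rw [div_pow δ, div_pow 4]
    field_simp

theorem exists_admissibleConstants {ξ η m M : ℝ} (hξη : ξ < η) (hm : 0 < m) {G : Set ℂ}
    (hG : IsOpen G) (hIG : ∀ x ∈ Set.Icc ξ η, (x : ℂ) ∈ G) {σ : ℂ → ℂ}
    (hσ : DifferentiableOn ℂ σ G) (hσm : ∀ x ∈ Set.Icc ξ η, m ≤ ‖σ x‖)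
    (hσM : ∀ z ∈ G, ‖σ z‖ ≤ M) : ∃ K₁ K₂ : ℝ, AdmissibleConstants σ ξ η M K₁ K₂ := by
  have hopen : IsOpen (G ∩ (fun w => ‖σ w‖) ⁻¹' Set.Ioi (m / 2)) :=
    hσ.continuousOn.norm.isOpen_inter_preimage hG isOpen_Ioi
  have hcpt : IsCompact (Complex.ofReal '' Set.Icc ξ η) :=
    isCompact_Icc.image Complex.continuous_ofReal
  obtain ⟨δ, hδ, hδU⟩ := hcpt.exists_thickening_subset_open hopen (by
    rintro _ ⟨x, hx, rfl⟩
    exact ⟨hIG x hx, lt_of_lt_of_le (by linarith) (hσm x hx)⟩)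
  have hM : 0 < M := hm.trans_le ((hσm ξ ⟨le_rfl, hξη.le⟩).trans (hσM _ (hIG ξ ⟨le_rfl, hξη.le⟩)))
  -- With `m' = m / 2`, the value `K = 1 / m' + M / m'^2` gives `K m' = 1 + M / m'` and `m' (K m') =
  -- m' + M`, which settles both conditions on `K`.
  have key : ∀ c : ℂ, ‖c‖ = 1 → Estimates (fun z => c * σ z) ξ η M (4 / δ)
      (2 * (1 / (m / 2) + M / (m / 2) ^ 2) / δ) := by
    intro c hc
    refine estimates_of_thickening (m := m / 2) hξη hδ (by positivity) ?_ ?_ ?_ ?_ ?_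
    · exact (hσ.mono fun z hz => (hδU hz).1).const_mul c
    · intro z hz
      simpa [hc] using (hδU hz).2.le
    · intro z hz
      simpa [hc] using hσM z (hδU hz).1
    · have : (1 / (m / 2) + M / (m / 2) ^ 2) * (m / 2) = 1 + M / (m / 2) := by field_simp
      rw [this]
      have : 0 ≤ M / (m / 2) := by positivity
      linarith
    · have : m / 2 * ((1 / (m / 2) + M / (m / 2) ^ 2) * (m / 2)) = m / 2 + M := by field_simp
      rw [this]
      linarith
  exact ⟨4 / δ, _, by positivity, by positivity, key (-Complex.I) (by simp), key Complex.I (by simp)⟩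

/-! ### Derivatives along the real interval. -/

section Derivatives

variable {s₀ : ℂ → ℂ} {U : Set ℂ} {ξ η x : ℝ}

theorem hasDerivAt_dS (hU : IsOpen U) (hs : DifferentiableOn ℂ s₀ U) (h0 : ∀ z ∈ U, s₀ z ≠ 0)
    (n : ℕ) (hx : (x : ℂ) ∈ U) :
    HasDerivAt (fun y : ℝ => dS s₀ n y) (deriv (dS s₀ n) x) x :=
  ((differentiableOn_dS hU hs h0 n).differentiableAt (hU.mem_nhds hx)).hasDerivAt.comp_ofReal

theorem continuousOn_dS (hU : IsOpen U) (hs : DifferentiableOn ℂ s₀ U)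
    (h0 : ∀ z ∈ U, s₀ z ≠ 0) (hIU : ∀ x ∈ Set.Icc ξ η, (x : ℂ) ∈ U) (n : ℕ) :
    ContinuousOn (fun y : ℝ => dS s₀ n y) (Set.Icc ξ η) := fun x hx =>
  (hasDerivAt_dS hU hs h0 n (hIU x hx)).continuousAt.continuousWithinAt

theorem hasDerivAt_S (hU : IsOpen U) (hs : DifferentiableOn ℂ s₀ U) (h0 : ∀ z ∈ U, s₀ z ≠ 0)
    (hIU : ∀ x ∈ Set.Icc ξ η, (x : ℂ) ∈ U) (n : ℕ) (hx : x ∈ Set.Icc ξ η) :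
    HasDerivAt (S s₀ ξ n) (dS s₀ n x) x := by
  refine intervalIntegral.integral_hasDerivAt_right ?_ ?_ ?_
  · refine ((continuousOn_dS hU hs h0 hIU n).mono ?_).intervalIntegrable
    rw [Set.uIcc_of_le hx.1]
    exact Set.Icc_subset_Icc_right hx.2
  · exact ContinuousAt.stronglyMeasurableAtFilter (hU.preimage Complex.continuous_ofReal)
      (fun y hy => (hasDerivAt_dS hU hs h0 n hy).continuousAt) x (hIU x hx)
  · exact (hasDerivAt_dS hU hs h0 n (hIU x hx)).continuousAt

theorem hasDerivAt_expSum (hU : IsOpen U) (hs : DifferentiableOn ℂ s₀ U)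
    (h0 : ∀ z ∈ U, s₀ z ≠ 0) (hIU : ∀ x ∈ Set.Icc ξ η, (x : ℂ) ∈ U) (N : ℕ) {ε : ℝ}
    (hε : ε ≠ 0) (hx : x ∈ Set.Icc ξ η) :
    HasDerivAt (expSum s₀ ξ N ε) ((ε : ℂ)⁻¹ * dSum s₀ N ε x * expSum s₀ ξ N ε x) x := by
  have hεc : (ε : ℂ) ≠ 0 := Complex.ofReal_ne_zero.2 hε
  have h := (HasDerivAt.fun_sum fun n (_ : n ∈ Finset.range (N + 1)) =>
    (hasDerivAt_S hU hs h0 hIU n hx).const_mul ((ε : ℂ) ^ ((n : ℤ) - 1))).cexp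
  refine h.congr_deriv ?_
  rw [mul_comm, expSum, dSum, Finset.mul_sum]
  congr 1
  refine Finset.sum_congr rfl fun n _ => ?_
  rw [zpow_sub_one₀ hεc, zpow_natCast]
  ring

theorem hasDerivAt_dSum (hU : IsOpen U) (hs : DifferentiableOn ℂ s₀ U)
    (h0 : ∀ z ∈ U, s₀ z ≠ 0) (N : ℕ) (ε : ℝ) (hx : (x : ℂ) ∈ U) :
    HasDerivAt (dSum s₀ N ε)
      (∑ n ∈ Finset.range (N + 1), (ε : ℂ) ^ n * deriv (dS s₀ n) x) x :=
  HasDerivAt.fun_sum fun n _ => (hasDerivAt_dS hU hs h0 n hx).const_mul _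

end Derivatives

/-! ### The residual of the truncated expansion. -/

section Residual

/-- Compare the truncated square with the full Cauchy product. They agree up to order `N`, where `ε
D_n` cancels them; at order `N + 1` the square lacks only the two pairs containing the index `N +
1`; orders `N + 2` to `2N` have nothing to cancel against. -/
theorem sq_sum_add_sum_sub_sq (s D : ℕ → ℂ) (ε : ℂ) (N : ℕ)
    (hD : ∀ n, D n = -∑ p ∈ Finset.HasAntidiagonal.antidiagonal (n + 1), s p.1 * s p.2) :
    (∑ n ∈ Finset.range (N + 1), ε ^ n * s n) ^ 2 +
        ε * (∑ n ∈ Finset.range (N + 1), ε ^ n * D n) - s 0 ^ 2 =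
      -(2 * ε ^ (N + 1) * (s 0 * s (N + 1))) + ∑ n ∈ Finset.Icc 2 N, ε ^ (N + n) *
        ∑ p ∈ Finset.range (N + 1) ×ˢ Finset.range (N + 1) with p.1 + p.2 = N + n,
          s p.1 * s p.2 := by
  set A : ℕ → ℂ := fun m =>
    ∑ p ∈ Finset.range (N + 1) ×ˢ Finset.range (N + 1) with p.1 + p.2 = m, s p.1 * s p.2
    with hA
  have hsq : (∑ n ∈ Finset.range (N + 1), ε ^ n * s n) ^ 2 =
      ∑ m ∈ Finset.range (N + 2 + (N - 1)), ε ^ m * A m := by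
    rw [sq, Finset.sum_mul_sum, ← Finset.sum_product', ← Finset.sum_fiberwise_of_maps_to
      (t := Finset.range (N + 2 + (N - 1))) (g := fun p : ℕ × ℕ => p.1 + p.2)]
    · refine Finset.sum_congr rfl fun m _ => ?_
      rw [hA, Finset.mul_sum]
      refine Finset.sum_congr rfl fun p hp => ?_
      rw [← (Finset.mem_filter.1 hp).2, pow_add]
      ring
    · intro p hp
      simp only [Finset.mem_product, Finset.mem_range] at hp ⊢
      omega
  have hlow : ∀ m ≤ N, A m = ∑ p ∈ Finset.HasAntidiagonal.antidiagonal m, s p.1 * s p.2 := by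
    intro m hm
    refine Finset.sum_congr ?_ fun _ _ => rfl
    ext p
    simp only [Finset.mem_filter, Finset.mem_product, Finset.mem_range, Finset.HasAntidiagonal.mem_antidiagonal]
    omega
  have hmid : ∑ p ∈ Finset.HasAntidiagonal.antidiagonal (N + 1), s p.1 * s p.2 =
      A (N + 1) + 2 * (s 0 * s (N + 1)) := by
    have : Finset.HasAntidiagonal.antidiagonal (N + 1) = insert (0, N + 1) (insert (N + 1, 0)
        ({p ∈ Finset.range (N + 1) ×ˢ Finset.range (N + 1) | p.1 + p.2 = N + 1})) := by
      ext ⟨i, j⟩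
      simp only [Finset.mem_filter, Finset.mem_product, Finset.mem_range,
        Finset.HasAntidiagonal.mem_antidiagonal, Finset.mem_insert, Prod.mk.injEq]
      omega
    rw [this, Finset.sum_insert (by simp), Finset.sum_insert (by simp)]
    simp only [hA]
    ring
  have hhigh : ∑ i ∈ Finset.range (N - 1), ε ^ (N + 2 + i) * A (N + 2 + i) =
      ∑ n ∈ Finset.Icc 2 N, ε ^ (N + n) * A (N + n) := by
    have : Finset.Icc 2 N = Finset.Ico 2 (N + 1) := by
      ext n; simp only [Finset.mem_Icc, Finset.mem_Ico]; omega
    rw [this, Finset.sum_Ico_eq_sum_range]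
    simp only [add_assoc]
    rfl
  have h1 : ∑ m ∈ Finset.range (N + 1), ε ^ m * A m =
      ∑ m ∈ Finset.range (N + 1), ε ^ m * ∑ p ∈ Finset.HasAntidiagonal.antidiagonal m, s p.1 * s p.2 :=
    Finset.sum_congr rfl fun m hm => by
      rw [hlow m (by rw [Finset.mem_range] at hm; omega)]
  have h2 : ε * (∑ n ∈ Finset.range (N + 1), ε ^ n * D n) + ∑ m ∈ Finset.range (N + 2),
      ε ^ m * ∑ p ∈ Finset.HasAntidiagonal.antidiagonal m, s p.1 * s p.2 = s 0 ^ 2 := by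
    rw [Finset.sum_range_succ' _ (N + 1), Finset.mul_sum, ← add_assoc, ← Finset.sum_add_distrib,
      Finset.sum_eq_zero]
    · simp [sq]
    · intro n _
      rw [hD]
      ring
  rw [Finset.sum_range_succ _ (N + 1), hmid] at h2
  rw [hsq, Finset.sum_range_add, Finset.sum_range_succ, h1, hhigh]
  linear_combination h2

/-- This is the recursion solved for the derivative: the two end terms of the antidiagonal supply `2
S_0' S_{n+1}'`. -/
theorem deriv_dS_eq {s₀ : ℂ → ℂ} {z : ℂ} (hz : s₀ z ≠ 0) (n : ℕ) :
    deriv (dS s₀ n) z =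
      -∑ p ∈ Finset.HasAntidiagonal.antidiagonal (n + 1), dS s₀ p.1 z * dS s₀ p.2 z := by
  have h := dS_recursion s₀ (n + 1) (by omega) z
  rw [Nat.add_sub_cancel] at h
  rw [Finset.Nat.sum_antidiagonal_eq_sum_range_succ (fun i j => dS s₀ i z * dS s₀ j z),
    Finset.sum_range_succ, ← Finset.sum_range_add_sum_Ico _ (by omega : 1 ≤ n + 1)]
  simp only [Finset.range_one, Finset.sum_singleton, Nat.sub_zero, Nat.sub_self, dS_zero]
  rw [h]
  field_simp
  ring

/-- The order of magnitude of the residual of the truncated expansion, up to `ε * M ^ 2`. -/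
noncomputable def truncationBound (K : ℝ) (N : ℕ) (ε : ℝ) : ℝ :=
  2 * ε ^ N * K ^ (N + 1) * ((N + 1 : ℕ) : ℝ) ^ (N + 1) +
    ∑ n ∈ Finset.Icc 2 N, ε ^ (N + n - 1) * K ^ (N + n) *
      ∑ k ∈ Finset.Icc 2 (N + n), (k : ℝ) ^ k * ((N + n - k : ℕ) : ℝ) ^ (N + n - k)

theorem truncationBound_nonneg {K ε : ℝ} (hK : 0 ≤ K) (hε : 0 ≤ ε) (N : ℕ) :
    0 ≤ truncationBound K N ε := by
  unfold truncationBound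
  positivity

theorem norm_residual_le {s₀ : ℂ → ℂ} {x M K ε : ℝ} (hz : s₀ x ≠ 0) (hM : 0 ≤ M) (hK : 0 ≤ K)
    (hε : 0 ≤ ε) (hb : ∀ n : ℕ, ‖dS s₀ n x‖ ≤ M * K ^ n * (n : ℝ) ^ n) (N : ℕ) :
    ‖dSum s₀ N ε x ^ 2 + ε * (∑ n ∈ Finset.range (N + 1), (ε : ℂ) ^ n * deriv (dS s₀ n) x) -
        s₀ x ^ 2‖ ≤ ε * (M ^ 2 * truncationBound K N ε) := by
  have h := sq_sum_add_sum_sub_sq (fun n => dS s₀ n x) (fun n => deriv (dS s₀ n) x) ε N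
    (deriv_dS_eq hz)
  simp only [dS_zero] at h
  have hε' : ‖(ε : ℂ)‖ = ε := by simp [abs_of_nonneg hε]
  rw [dSum, h]
  have h1 : ‖-(2 * (ε : ℂ) ^ (N + 1) * (s₀ x * dS s₀ (N + 1) x))‖ ≤
      ε * (M ^ 2 * (2 * ε ^ N * K ^ (N + 1) * ((N + 1 : ℕ) : ℝ) ^ (N + 1))) := by
    have h0 : ‖s₀ x‖ ≤ M := by simpa [dS_zero] using hb 0
    rw [norm_neg, norm_mul, norm_mul, norm_mul, norm_pow, hε', Complex.norm_ofNat]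
    calc _ ≤ 2 * ε ^ (N + 1) * (M * (M * K ^ (N + 1) * ((N + 1 : ℕ) : ℝ) ^ (N + 1))) := by
          gcongr
          exact hb (N + 1)
      _ = _ := by ring
  have h2 : ∀ n ∈ Finset.Icc 2 N, ‖(ε : ℂ) ^ (N + n) *
      ∑ p ∈ Finset.range (N + 1) ×ˢ Finset.range (N + 1) with p.1 + p.2 = N + n,
        dS s₀ p.1 x * dS s₀ p.2 x‖ ≤ ε * (M ^ 2 * (ε ^ (N + n - 1) * K ^ (N + n) *
      ∑ k ∈ Finset.Icc 2 (N + n), (k : ℝ) ^ k * ((N + n - k : ℕ) : ℝ) ^ (N + n - k))) := by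
    intro n hn
    rw [Finset.mem_Icc] at hn
    have h3 : ‖∑ p ∈ Finset.range (N + 1) ×ˢ Finset.range (N + 1) with p.1 + p.2 = N + n,
        dS s₀ p.1 x * dS s₀ p.2 x‖ ≤ M ^ 2 * K ^ (N + n) *
        ∑ k ∈ Finset.Icc 2 (N + n), (k : ℝ) ^ k * ((N + n - k : ℕ) : ℝ) ^ (N + n - k) := by
      rw [Finset.mul_sum]
      calc _ ≤ ∑ p ∈ Finset.range (N + 1) ×ˢ Finset.range (N + 1) with p.1 + p.2 = N + n,
            M ^ 2 * K ^ (N + n) *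
              ((p.1 : ℝ) ^ p.1 * ((N + n - p.1 : ℕ) : ℝ) ^ (N + n - p.1)) := by
            refine norm_sum_le_of_le _ fun p hp => ?_
            have hp' := (Finset.mem_filter.1 hp).2
            rw [← hp', Nat.add_sub_cancel_left, norm_mul]
            calc _ ≤ (M * K ^ p.1 * (p.1 : ℝ) ^ p.1) * (M * K ^ p.2 * (p.2 : ℝ) ^ p.2) :=
                  mul_le_mul (hb _) (hb _) (norm_nonneg _) (by positivity)
              _ = _ := by ring
        _ = ∑ k ∈ ({p ∈ Finset.range (N + 1) ×ˢ Finset.range (N + 1) |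
              p.1 + p.2 = N + n}).image Prod.fst, M ^ 2 * K ^ (N + n) *
              ((k : ℝ) ^ k * ((N + n - k : ℕ) : ℝ) ^ (N + n - k)) := by
            rw [Finset.sum_image]
            rintro ⟨i, j⟩ hp ⟨i', j'⟩ hp' hii
            simp only [Finset.coe_filter, Set.mem_ofPred_eq] at hp hp' hii
            ext <;> simp <;> omega
        _ ≤ _ := by
            -- Both indices are at most `N` and add up to `N + n`, so each is at least `n ≥ 2`.
            refine Finset.sum_le_sum_of_subset_of_nonneg ?_ fun _ _ _ => by positivity
            intro k hk
            obtain ⟨⟨i, j⟩, hp, rfl⟩ := Finset.mem_image.1 hk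
            simp only [Finset.mem_filter, Finset.mem_product, Finset.mem_range] at hp
            rw [Finset.mem_Icc]
            dsimp only
            omega
    rw [norm_mul, norm_pow, hε']
    calc _ ≤ ε ^ (N + n) * _ := mul_le_mul_of_nonneg_left h3 (by positivity)
      _ = _ := by
          obtain ⟨k, hk⟩ : ∃ k, N + n = k + 1 := ⟨N + n - 1, by omega⟩
          rw [hk, Nat.add_sub_cancel, pow_succ ε]
          ring
  refine (norm_add_le _ _).trans ((add_le_add h1 (norm_sum_le_of_le _ h2)).trans (le_of_eq ?_))
  rw [truncationBound, mul_add, mul_add, Finset.mul_sum, Finset.mul_sum]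

end Residual

/-! ### Size of the exponentials and of the denominator. -/

section Size

theorem pow_mul_pow_self_le {ε K : ℝ} (hε : 0 ≤ ε) (hK : 0 ≤ K) {N n : ℕ} (hn : n ≤ N) :
    ε ^ n * K ^ n * (n : ℝ) ^ n ≤ (ε * K * (N + 1)) ^ n := by
  rw [← mul_pow, ← mul_pow]
  have : (n : ℝ) ≤ N := by exact_mod_cast hn
  gcongr
  linarith

theorem norm_S_le {s₀ : ℂ → ℂ} {ξ η B : ℝ} {n : ℕ}
    (hb : ∀ x ∈ Set.Icc ξ η, ‖dS s₀ n x‖ ≤ B) {x : ℝ} (hx : x ∈ Set.Icc ξ η) :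
    ‖S s₀ ξ n x‖ ≤ (η - ξ) * B := by
  have hB : 0 ≤ B := (norm_nonneg _).trans (hb x hx)
  have h := intervalIntegral.norm_integral_le_of_norm_le_const (a := ξ) (b := x)
    (f := fun τ : ℝ => dS s₀ n (τ : ℂ)) (C := B) (fun τ hτ => by
      rw [Set.uIoc_of_le hx.1] at hτ
      exact hb τ ⟨hτ.1.le, hτ.2.trans hx.2⟩)
  rw [S]
  refine h.trans ?_
  rw [abs_of_nonneg (by linarith [hx.1]), mul_comm]
  gcongr
  exact hx.2

theorem re_S_zero {s₀ : ℂ → ℂ} {ξ η x : ℝ} (h : ∀ x ∈ Set.Icc ξ η, (s₀ x).re = 0)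
    (hx : x ∈ Set.Icc ξ η) : (S s₀ ξ 0 x).re = 0 := by
  have : S s₀ ξ 0 x = ((∫ τ in ξ..x, (s₀ τ).im : ℝ) : ℂ) * Complex.I := by
    rw [← intervalIntegral.integral_ofReal, ← intervalIntegral.integral_mul_const, S]
    refine intervalIntegral.integral_congr fun τ hτ => ?_
    rw [Set.uIcc_of_le hx.1] at hτ
    simp only [dS_zero]
    apply Complex.ext <;> simp [h τ ⟨hτ.1, hτ.2.trans hx.2⟩]
  simp [this]

/-- The singular term `S_0 / ε` only contributes a phase. In the other terms one factor `n + 1` is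
split off and bounded by `2^n`, against `(1/4)^n` from the smallness of `ε`; the series is then
geometric with ratio `1/2`, whatever `N` is. -/
theorem norm_expSum_le {s₀ : ℂ → ℂ} {ξ η M K ε x : ℝ} (hM : 0 ≤ M) (hK : 0 ≤ K) (hε : 0 < ε)
    (hre : ∀ x ∈ Set.Icc ξ η, (s₀ x).re = 0)
    (hb : ∀ n : ℕ, ∀ x ∈ Set.Icc ξ η, ‖dS s₀ n x‖ ≤ M * K ^ n * (n : ℝ) ^ n) {N : ℕ}
    (hεN : ε * K * (N + 1) ≤ 1 / 4) (hx : x ∈ Set.Icc ξ η) :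
    ‖expSum s₀ ξ N ε x‖ ≤ Real.exp ((η - ξ) * M * (2 * K)) := by
  have hL : 0 ≤ η - ξ := by linarith [hx.1, hx.2]
  rw [expSum, Complex.norm_exp, Real.exp_le_exp, Finset.sum_range_succ', Complex.add_re]
  have h0 : ((ε : ℂ) ^ (((0 : ℕ) : ℤ) - 1) * S s₀ ξ 0 x).re = 0 := by
    have : (ε : ℂ) ^ (((0 : ℕ) : ℤ) - 1) = ((ε⁻¹ : ℝ) : ℂ) := by simp
    rw [this, Complex.re_ofReal_mul, re_S_zero hre hx, mul_zero]
  rw [h0, add_zero]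
  refine (Complex.re_le_norm _).trans ?_
  calc _ ≤ ∑ n ∈ Finset.range N, (η - ξ) * M * K * (1 / 2 : ℝ) ^ n := by
        refine norm_sum_le_of_le _ fun n hn => ?_
        rw [Finset.mem_range] at hn
        have hz : (ε : ℂ) ^ (((n + 1 : ℕ) : ℤ) - 1) = (ε : ℂ) ^ n := by
          rw [Nat.cast_succ, add_sub_cancel_right, zpow_natCast]
        rw [hz, norm_mul, norm_pow, Complex.norm_real, Real.norm_of_nonneg hε.le]
        have h1 := norm_S_le (hb (n + 1)) hx
        have h2 : (ε * K * (n + 1)) ^ n ≤ (1 / 4) ^ n := by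
          have : (n : ℝ) ≤ N := by exact_mod_cast hn.le
          exact pow_le_pow_left₀ (by positivity) (le_trans (by gcongr) hεN) n
        have h3 : ((n : ℝ) + 1) ≤ 2 ^ n := by exact_mod_cast Nat.lt_two_pow_self (n := n)
        calc _ ≤ ε ^ n * ((η - ξ) * (M * K ^ (n + 1) * ((n + 1 : ℕ) : ℝ) ^ (n + 1))) := by
              gcongr
          _ = (η - ξ) * M * K * ((ε * K * (n + 1)) ^ n * (n + 1)) := by
              push_cast
              rw [mul_pow, mul_pow]
              ring
          _ ≤ (η - ξ) * M * K * ((1 / 4) ^ n * 2 ^ n) := by gcongr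
          _ = _ := by rw [← mul_pow]; norm_num
    _ = (η - ξ) * M * K * ∑ n ∈ Finset.range N, (1 / 2 : ℝ) ^ n := by rw [Finset.mul_sum]
    _ ≤ (η - ξ) * M * K * 2 := by gcongr; exact sum_geometric_two_le N
    _ = _ := by ring

theorem norm_dSum_le {s₀ : ℂ → ℂ} {M K ε x : ℝ} (hε : 0 ≤ ε)
    (hb : ∀ n : ℕ, ‖dS s₀ n x‖ ≤ M * K ^ n * (n : ℝ) ^ n) (N : ℕ) :
    ‖dSum s₀ N ε x‖ ≤ M * ∑ n ∈ Finset.range (N + 1), ε ^ n * K ^ n * (n : ℝ) ^ n := by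
  rw [Finset.mul_sum]
  refine norm_sum_le_of_le _ fun n _ => ?_
  rw [norm_mul, norm_pow, Complex.norm_real, Real.norm_of_nonneg hε]
  calc _ ≤ ε ^ n * (M * K ^ n * (n : ℝ) ^ n) := by gcongr; exact hb n
    _ = _ := by ring

/-- The leading term has modulus `2 ‖σ ξ‖ ≥ 2 m`; the condition with `m / (4 M)` keeps all
corrections together below `m`. -/
theorem le_norm_denom {σ : ℂ → ℂ} {ξ m M K ε : ℝ} (hm : m ≤ ‖σ ξ‖) (hM : 0 < M) (hK : 0 ≤ K)
    (hε : 0 ≤ ε) (hp : ∀ n : ℕ, ‖dS (sPlus σ) n ξ‖ ≤ M * K ^ n * (n : ℝ) ^ n)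
    (hn : ∀ n : ℕ, ‖dS (sMinus σ) n ξ‖ ≤ M * K ^ n * (n : ℝ) ^ n) {N : ℕ}
    (hεN : ε * K * (N + 1) ≤ 1 / 4) (hεM : ε * K * (N + 1) ≤ m / (4 * M)) :
    m ≤ ‖denom σ ξ N ε‖ := by
  set q := ε * K * (N + 1) with hq
  have hq0 : 0 ≤ q := by positivity
  rw [denom, Finset.sum_range_succ']
  have h1 : ‖∑ n ∈ Finset.range N, (ε : ℂ) ^ (n + 1) *
      (dS (sPlus σ) (n + 1) ξ - dS (sMinus σ) (n + 1) ξ)‖ ≤ m := by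
    calc _ ≤ ∑ n ∈ Finset.range N, 2 * M * q * (1 / 2 : ℝ) ^ n := by
          refine norm_sum_le_of_le _ fun n hn' => ?_
          rw [Finset.mem_range] at hn'
          rw [norm_mul, norm_pow, Complex.norm_real, Real.norm_of_nonneg hε]
          calc _ ≤ ε ^ (n + 1) * (M * K ^ (n + 1) * ((n + 1 : ℕ) : ℝ) ^ (n + 1) +
                M * K ^ (n + 1) * ((n + 1 : ℕ) : ℝ) ^ (n + 1)) := by
                gcongr
                exact (norm_sub_le _ _).trans (add_le_add (hp _) (hn _))
            _ = 2 * M * (ε ^ (n + 1) * K ^ (n + 1) * ((n + 1 : ℕ) : ℝ) ^ (n + 1)) := by ring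
            _ ≤ 2 * M * q ^ (n + 1) := by
                have := pow_mul_pow_self_le hε hK (N := N) (n := n + 1) hn'
                gcongr
            _ = 2 * M * q * q ^ n := by ring
            _ ≤ _ := by gcongr; linarith
      _ = 2 * M * q * ∑ n ∈ Finset.range N, (1 / 2 : ℝ) ^ n := by rw [Finset.mul_sum]
      _ ≤ 2 * M * q * 2 := by gcongr; exact sum_geometric_two_le N
      _ = q * (4 * M) := by ring
      _ ≤ m := (le_div_iff₀ (by positivity)).1 hεM
  have h2 : (ε : ℂ) ^ 0 * (dS (sPlus σ) 0 ξ - dS (sMinus σ) 0 ξ) = 2 * Complex.I * σ ξ := by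
    simp only [dS_zero, sPlus, sMinus]
    ring
  have h3 : ‖2 * Complex.I * σ ξ‖ = 2 * ‖σ ξ‖ := by simp
  rw [h2, add_comm]
  have := norm_sub_le_norm_add (2 * Complex.I * σ ξ) (∑ n ∈ Finset.range N, (ε : ℂ) ^ (n + 1) *
      (dS (sPlus σ) (n + 1) ξ - dS (sMinus σ) (n + 1) ξ))
  linarith

end Size

/-! ### Energy estimate for the oscillator. -/

/-- Stability of `ε² e'' + s² e = ε F` with zero initial data, uniformly in `ε`. -/
theorem norm_le_of_oscillator {ξ η m D : ℝ} (hm : 0 < m) (hD : 0 ≤ D) {s s' : ℝ → ℝ}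
    (hs : ∀ x ∈ Set.Icc ξ η, HasDerivWithinAt s (s' x) (Set.Icc ξ η) x)
    (hsm : ∀ x ∈ Set.Icc ξ η, m ≤ s x) (hsD : ∀ x ∈ Set.Icc ξ η, |s' x| ≤ D)
    {e de dde : ℝ → ℂ} {ε B : ℝ} (hB : 0 ≤ B)
    (he : ∀ x ∈ Set.Icc ξ η, HasDerivWithinAt e (de x) (Set.Icc ξ η) x)
    (hde : ∀ x ∈ Set.Icc ξ η, HasDerivWithinAt de (dde x) (Set.Icc ξ η) x)
    (hF : ∀ x ∈ Set.Icc ξ η, ‖(ε : ℂ) ^ 2 * dde x + (s x : ℂ) ^ 2 * e x‖ ≤ |ε| * B)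
    (he0 : e ξ = 0) (hde0 : de ξ = 0) {x : ℝ} (hx : x ∈ Set.Icc ξ η) :
    ‖e x‖ ≤ Real.sqrt (Real.exp ((1 + 2 * D / m) * (η - ξ)) * (η - ξ)) / m * B := by
  set k := 1 + 2 * D / m with hk
  have hk0 : 0 ≤ k := by positivity
  have hL : 0 ≤ η - ξ := by linarith [hx.1, hx.2]
  set E : ℝ → ℝ := fun x => ε ^ 2 * ‖de x‖ ^ 2 + s x ^ 2 * ‖e x‖ ^ 2 with hE
  set E' : ℝ → ℝ := fun x => ε ^ 2 * (2 * inner ℝ (de x) (dde x)) +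
    (2 * s x * s' x * ‖e x‖ ^ 2 + s x ^ 2 * (2 * inner ℝ (e x) (de x))) with hE'
  have hEd : ∀ x ∈ Set.Icc ξ η, HasDerivWithinAt E (E' x) (Set.Icc ξ η) x := by
    intro x hx
    refine (((hde x hx).norm_sq.const_mul (ε ^ 2)).add
      (((hs x hx).pow 2).mul (he x hx).norm_sq)).congr_deriv ?_
    simp only [hE']
    simp
  have hE'le : ∀ x ∈ Set.Icc ξ η, E' x ≤ k * E x + B ^ 2 := by
    intro x hx
    -- The cross terms of the energy derivative combine into the pairing of `e'` with the equation's
    -- right-hand side, so no negative power of `ε` appears.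
    have h1 : ε ^ 2 * (2 * inner ℝ (de x) (dde x)) + s x ^ 2 * (2 * inner ℝ (e x) (de x)) =
        2 * inner ℝ (de x) ((ε : ℂ) ^ 2 * dde x + (s x : ℂ) ^ 2 * e x) := by
      have h3 : (ε : ℂ) ^ 2 * dde x = (ε ^ 2 : ℝ) • dde x := by
        rw [Complex.real_smul]; push_cast; ring
      have h4 : (s x : ℂ) ^ 2 * e x = (s x ^ 2 : ℝ) • e x := by
        rw [Complex.real_smul]; push_cast; ring
      rw [h3, h4, inner_add_right, inner_smul_right_eq_smul, inner_smul_right_eq_smul,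
        real_inner_comm (de x) (e x)]
      simp only [smul_eq_mul]
      ring
    have h2 : 2 * inner ℝ (de x) ((ε : ℂ) ^ 2 * dde x + (s x : ℂ) ^ 2 * e x) ≤
        ε ^ 2 * ‖de x‖ ^ 2 + B ^ 2 := by
      have h5 := (real_inner_le_norm (de x) ((ε : ℂ) ^ 2 * dde x + (s x : ℂ) ^ 2 * e x)).trans
        (mul_le_mul_of_nonneg_left (hF x hx) (norm_nonneg _))
      nlinarith [sq_nonneg (|ε| * ‖de x‖ - B), sq_abs ε]
    have h6 : 2 * s x * s' x * ‖e x‖ ^ 2 ≤ 2 * D / m * (s x ^ 2 * ‖e x‖ ^ 2) := by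
      have hsx : 0 < s x := hm.trans_le (hsm x hx)
      calc 2 * s x * s' x * ‖e x‖ ^ 2 ≤ 2 * s x * D * ‖e x‖ ^ 2 := by
            gcongr
            exact (le_abs_self _).trans (hsD x hx)
        _ = 2 * D / m * (s x * m * ‖e x‖ ^ 2) := by field_simp
        _ ≤ 2 * D / m * (s x * s x * ‖e x‖ ^ 2) := by
            have := hsm x hx
            gcongr
        _ = _ := by ring
    have h7 : 0 ≤ 2 * D / m * (ε ^ 2 * ‖de x‖ ^ 2) := by positivity
    have h8 : k * E x = ε ^ 2 * ‖de x‖ ^ 2 + s x ^ 2 * ‖e x‖ ^ 2 +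
        2 * D / m * (ε ^ 2 * ‖de x‖ ^ 2) + 2 * D / m * (s x ^ 2 * ‖e x‖ ^ 2) := by
      rw [hk, hE]; ring
    have h9 : 0 ≤ s x ^ 2 * ‖e x‖ ^ 2 := by positivity
    rw [h8]
    simp only [hE']
    linarith
  -- Grönwall's argument with the integrating factor `exp(-k (x - ξ))`, which is at most 1.
  have hanti : AntitoneOn (fun x => Real.exp (-(k * (x - ξ))) * E x - B ^ 2 * (x - ξ))
      (Set.Icc ξ η) := by
    have hd : ∀ x ∈ Set.Icc ξ η, HasDerivWithinAt
        (fun x => Real.exp (-(k * (x - ξ))) * E x - B ^ 2 * (x - ξ))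
        (Real.exp (-(k * (x - ξ))) * (E' x - k * E x) - B ^ 2) (Set.Icc ξ η) x := by
      intro x hx
      have h1 : HasDerivWithinAt (fun x => x - ξ) 1 (Set.Icc ξ η) x :=
        (hasDerivWithinAt_id x _).sub_const ξ
      refine (((h1.const_mul k).neg.exp.mul (hEd x hx)).sub (h1.const_mul (B ^ 2))).congr_deriv ?_
      simp only [Pi.neg_apply]
      ring
    refine antitoneOn_of_hasDerivWithinAt_nonpos (convex_Icc ξ η)
      (fun x hx => (hd x hx).continuousWithinAt)
      (fun x hx => (hd x (interior_subset hx)).mono interior_subset) fun x hx => ?_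
    have hx' := interior_subset hx
    have h1 : Real.exp (-(k * (x - ξ))) ≤ 1 := Real.exp_le_one_iff.2 (by
      have : 0 ≤ k * (x - ξ) := mul_nonneg hk0 (by linarith [hx'.1])
      linarith)
    have h2 := hE'le x hx'
    calc _ ≤ Real.exp (-(k * (x - ξ))) * B ^ 2 - B ^ 2 := by gcongr; linarith
      _ ≤ 0 := by nlinarith [sq_nonneg B]
  have h0 : E ξ = 0 := by simp [hE, he0, hde0]
  have h1 := hanti ⟨le_rfl, hx.1.trans hx.2⟩ hx hx.1
  simp only [h0, sub_self, mul_zero] at h1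
  have h2 : E x ≤ Real.exp (k * (η - ξ)) * (η - ξ) * B ^ 2 := by
    have h3 : Real.exp (-(k * (x - ξ))) * E x ≤ B ^ 2 * (η - ξ) := by
      nlinarith [sq_nonneg B, hx.2]
    calc E x = Real.exp (k * (x - ξ)) * (Real.exp (-(k * (x - ξ))) * E x) := by
          rw [← mul_assoc, ← Real.exp_add]; simp
      _ ≤ Real.exp (k * (η - ξ)) * (B ^ 2 * (η - ξ)) := by
          gcongr
          exact hx.2
      _ = _ := by ring
  have h4 : (m * ‖e x‖) ^ 2 ≤ Real.exp (k * (η - ξ)) * (η - ξ) * B ^ 2 := by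
    refine le_trans ?_ h2
    have h5 : m ^ 2 ≤ s x ^ 2 := pow_le_pow_left₀ hm.le (hsm x hx) 2
    have h6 : m ^ 2 * ‖e x‖ ^ 2 ≤ s x ^ 2 * ‖e x‖ ^ 2 := by gcongr
    have h7 : 0 ≤ ε ^ 2 * ‖de x‖ ^ 2 := by positivity
    rw [mul_pow]
    simp only [hE]
    linarith
  have h5 := Real.le_sqrt_of_sq_le h4
  rw [Real.sqrt_mul' _ (sq_nonneg B), Real.sqrt_sq hB] at h5
  rw [div_mul_eq_mul_div, le_div_iff₀ hm]
  linarith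

/-! ### The error estimate for given `N` and `ε`. -/

/-- The case `k = 1` of the estimates concerns `S_n'` itself, and continuity makes it pointwise. -/
theorem norm_dS_le_of_estimates {s₀ : ℂ → ℂ} {ξ η M K₁ K₂ : ℝ} (hξη : ξ < η) (hM : 0 ≤ M)
    (hK₂ : 0 ≤ K₂) (h : Estimates s₀ ξ η M K₁ K₂) {U : Set ℂ} (hU : IsOpen U)
    (hs : DifferentiableOn ℂ s₀ U) (h0 : ∀ z ∈ U, s₀ z ≠ 0)
    (hIU : ∀ x ∈ Set.Icc ξ η, (x : ℂ) ∈ U) (n : ℕ) {x : ℝ} (hx : x ∈ Set.Icc ξ η) :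
    ‖dS s₀ n x‖ ≤ M * K₂ ^ n * (n : ℝ) ^ n := by
  have h1 := h.2 n 1 le_rfl
  simp only [Nat.sub_self, iteratedDeriv_zero, Nat.factorial_zero, Nat.cast_one, mul_one,
    pow_zero] at h1
  exact norm_le_of_LInf_Icc_le hξη (by positivity) (continuousOn_dS hU hs h0 hIU n) h1 hx

theorem expSum_left (s₀ : ℂ → ℂ) (ξ : ℝ) (N : ℕ) (ε : ℝ) : expSum s₀ ξ N ε ξ = 1 := by
  simp [expSum, S]

theorem denom_eq (σ : ℂ → ℂ) (ξ : ℝ) (N : ℕ) (ε : ℝ) :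
    denom σ ξ N ε = dSum (sPlus σ) N ε ξ - dSum (sMinus σ) N ε ξ := by
  simp only [denom, dSum, mul_sub, Finset.sum_sub_distrib]

theorem hasDerivAt_deriv_expSum {s₀ : ℂ → ℂ} {U : Set ℂ} {ξ η x : ℝ} (hU : IsOpen U)
    (hs : DifferentiableOn ℂ s₀ U) (h0 : ∀ z ∈ U, s₀ z ≠ 0)
    (hIU : ∀ x ∈ Set.Icc ξ η, (x : ℂ) ∈ U) (N : ℕ) {ε : ℝ} (hε : ε ≠ 0)
    (hx : x ∈ Set.Icc ξ η) :
    HasDerivAt (fun y => (ε : ℂ)⁻¹ * dSum s₀ N ε y * expSum s₀ ξ N ε y)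
      ((ε : ℂ)⁻¹ * (∑ n ∈ Finset.range (N + 1), (ε : ℂ) ^ n * deriv (dS s₀ n) x) *
        expSum s₀ ξ N ε x +
        (ε : ℂ)⁻¹ * dSum s₀ N ε x * ((ε : ℂ)⁻¹ * dSum s₀ N ε x * expSum s₀ ξ N ε x)) x :=
  ((hasDerivAt_dSum hU hs h0 N ε (hIU x hx)).const_mul _).mul
    (hasDerivAt_expSum hU hs h0 hIU N hε hx)

theorem norm_sub_approx_le {ξ η m M K₁ K₂ D : ℝ} (hξη : ξ < η) (hm : 0 < m) (hM : 0 < M)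
    {a : ℝ → ℝ} {σ : ℂ → ℂ} {U : Set ℂ} (hU : IsOpen U) (hσ : DifferentiableOn ℂ σ U)
    (h0 : ∀ z ∈ U, σ z ≠ 0) (hIU : ∀ x ∈ Set.Icc ξ η, (x : ℂ) ∈ U)
    (hσim : ∀ x ∈ Set.Icc ξ η, σ x = ((σ x).re : ℂ))
    (hσm : ∀ x ∈ Set.Icc ξ η, m ≤ (σ x).re) (ha : ∀ x ∈ Set.Icc ξ η, (σ x).re ^ 2 = a x)
    (hD0 : 0 ≤ D) (hD : ∀ x ∈ Set.Icc ξ η, ‖deriv σ x‖ ≤ D)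
    (hK : AdmissibleConstants σ ξ η M K₁ K₂) {N : ℕ} {ε : ℝ} (hε : 0 < ε)
    (hε4 : ε * K₂ * (N + 1) ≤ 1 / 4) (hεM : ε * K₂ * (N + 1) ≤ m / (4 * M)) :
    denom σ ξ N ε ≠ 0 ∧ ∀ (φ₀ φ₁ : ℂ) (φ : ℝ → ℂ), IsSolution a ξ η ε φ₀ φ₁ φ →
      ∀ x ∈ Set.Icc ξ η, ‖φ x - approx σ ξ N ε φ₀ φ₁ x‖ ≤
        errorBound (Real.sqrt (Real.exp ((1 + 2 * D / m) * (η - ξ)) * (η - ξ)) / m *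
          (2 * Real.exp ((η - ξ) * M * (2 * K₂)) / m)) (η - ξ) M K₂ N ε ‖φ₀‖ ‖φ₁‖ := by
  obtain ⟨-, hK₂, hem, hep⟩ := hK
  have hξ : ξ ∈ Set.Icc ξ η := ⟨le_rfl, hξη.le⟩
  have hεc : (ε : ℂ) ≠ 0 := Complex.ofReal_ne_zero.2 hε.ne'
  have hsp : DifferentiableOn ℂ (sPlus σ) U := hσ.const_mul _
  have hsm : DifferentiableOn ℂ (sMinus σ) U := hσ.const_mul _
  have hp0 : ∀ z ∈ U, sPlus σ z ≠ 0 := fun z hz => mul_ne_zero Complex.I_ne_zero (h0 z hz)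
  have hm0 : ∀ z ∈ U, sMinus σ z ≠ 0 := fun z hz =>
    mul_ne_zero (neg_ne_zero.2 Complex.I_ne_zero) (h0 z hz)
  have hbp : ∀ n : ℕ, ∀ x ∈ Set.Icc ξ η, ‖dS (sPlus σ) n x‖ ≤ M * K₂ ^ n * (n : ℝ) ^ n :=
    fun n x hx => norm_dS_le_of_estimates hξη hM.le hK₂.le hep hU hsp hp0 hIU n hx
  have hbm : ∀ n : ℕ, ∀ x ∈ Set.Icc ξ η, ‖dS (sMinus σ) n x‖ ≤ M * K₂ ^ n * (n : ℝ) ^ n :=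
    fun n x hx => norm_dS_le_of_estimates hξη hM.le hK₂.le hem hU hsm hm0 hIU n hx
  have hσnorm : m ≤ ‖σ ξ‖ := (hσm ξ hξ).trans ((le_abs_self _).trans (Complex.abs_re_le_norm _))
  have hden := le_norm_denom hσnorm hM hK₂.le hε.le (fun n => hbp n ξ hξ) (fun n => hbm n ξ hξ)
    hε4 hεM
  have hden0 : denom σ ξ N ε ≠ 0 := norm_pos_iff.1 (hm.trans_le hden)
  refine ⟨hden0, fun φ₀ φ₁ φ ⟨dφ, ddφ, hdφ, hddφ, hode, hi0, hi1⟩ => ?_⟩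
  set R := ∑ n ∈ Finset.range (N + 1), ε ^ n * K₂ ^ n * (n : ℝ) ^ n with hR
  have hR0 : 0 ≤ R := by positivity
  set P := ‖φ₀‖ * M * R + ‖φ₁‖ with hP
  have hP0 : 0 ≤ P := by positivity
  have hcoef : ∀ u : ℂ, ‖u‖ ≤ M * R → ‖φ₀ * u‖ + ‖φ₁‖ ≤ P := fun u hu => by
    rw [norm_mul, hP, mul_assoc]
    gcongr
  have hα : ‖alpha σ ξ N ε φ₀ φ₁‖ ≤ P / m := by
    rw [alpha, norm_div]
    gcongr
    exact (norm_sub_le _ _).trans (hcoef _ (norm_dSum_le hε.le (fun n => hbp n ξ hξ) N))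
  have hβ : ‖beta σ ξ N ε φ₀ φ₁‖ ≤ P / m := by
    rw [beta, norm_div]
    gcongr
    refine (norm_sub_le _ _).trans ?_
    rw [add_comm]
    exact hcoef _ (norm_dSum_le hε.le (fun n => hbm n ξ hξ) N)
  -- The coefficients solve the 2×2 system for the value and the scaled derivative at `ξ`, so the
  -- error has zero initial data.
  have hsum : alpha σ ξ N ε φ₀ φ₁ + beta σ ξ N ε φ₀ φ₁ = φ₀ := by
    rw [alpha, beta, ← add_div, div_eq_iff hden0, denom_eq]
    ring
  have hsum' : alpha σ ξ N ε φ₀ φ₁ * dSum (sMinus σ) N ε ξ +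
      beta σ ξ N ε φ₀ φ₁ * dSum (sPlus σ) N ε ξ = φ₁ := by
    rw [alpha, beta, div_mul_eq_mul_div, div_mul_eq_mul_div, ← add_div, div_eq_iff hden0, denom_eq]
    ring
  set α := alpha σ ξ N ε φ₀ φ₁
  set β := beta σ ξ N ε φ₀ φ₁
  set W := Real.exp ((η - ξ) * M * (2 * K₂)) with hW
  set T := truncationBound K₂ N ε with hT
  have hT0 : 0 ≤ T := truncationBound_nonneg hK₂.le hε.le N
  have hwp : ∀ x ∈ Set.Icc ξ η, ‖expSum (sPlus σ) ξ N ε x‖ ≤ W := fun x hx =>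
    norm_expSum_le hM.le hK₂.le hε (fun x hx => by rw [sPlus, hσim x hx]; simp) hbp hε4 hx
  have hwm : ∀ x ∈ Set.Icc ξ η, ‖expSum (sMinus σ) ξ N ε x‖ ≤ W := fun x hx =>
    norm_expSum_le hM.le hK₂.le hε (fun x hx => by rw [sMinus, hσim x hx]; simp) hbm hε4 hx
  have hrp := fun x hx => norm_residual_le (hp0 _ (hIU x hx)) hM.le hK₂.le hε.le
    (fun n => hbp n x hx) N
  have hrm := fun x hx => norm_residual_le (hm0 _ (hIU x hx)) hM.le hK₂.le hε.le
    (fun n => hbm n x hx) N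
  have key := fun x hx => norm_le_of_oscillator (ξ := ξ) (η := η) (x := x) (ε := ε)
    (B := 2 * (P / m * (M ^ 2 * T * W))) hm hD0
    (s := fun x : ℝ => (σ x).re) (s' := fun x : ℝ => (deriv σ x).re)
    (fun x hx =>
      ((hσ.differentiableAt (hU.mem_nhds (hIU x hx))).hasDerivAt.real_of_complex).hasDerivWithinAt)
    hσm (fun x hx => (Complex.abs_re_le_norm _).trans (hD x hx)) (by positivity)
    (fun x hx => (hdφ x hx).sub
      (((hasDerivAt_expSum hU hsm hm0 hIU N hε.ne' hx).const_mul α).add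
        ((hasDerivAt_expSum hU hsp hp0 hIU N hε.ne' hx).const_mul β)).hasDerivWithinAt)
    (fun x hx => (hddφ x hx).sub
      (((hasDerivAt_deriv_expSum hU hsm hm0 hIU N hε.ne' hx).const_mul α).add
        ((hasDerivAt_deriv_expSum hU hsp hp0 hIU N hε.ne' hx).const_mul β)).hasDerivWithinAt)
    ?_ ?_ ?_ hx
  · intro x hx
    refine (key x hx).trans ?_
    -- The exponential factor of the claimed bound is only needed to be at least 1: the actual size
    -- `W` of the exponentials does not depend on `N` or `ε` and goes into the constant.
    have hexp : (1 : ℝ) ≤ Real.exp ((η - ξ) * M * ∑ n ∈ Finset.range (N / 2 + 1),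
        ε ^ (2 * n) * K₂ ^ (2 * n + 1) * ((2 * n + 1 : ℕ) : ℝ) ^ (2 * n + 1)) := by
      refine Real.one_le_exp ?_
      have : 0 ≤ η - ξ := by linarith
      exact mul_nonneg (mul_nonneg this hM.le) (Finset.sum_nonneg fun _ _ => by positivity)
    set A := Real.sqrt (Real.exp ((1 + 2 * D / m) * (η - ξ)) * (η - ξ)) / m
    have hA0 : 0 ≤ A := by positivity
    calc A * (2 * (P / m * (M ^ 2 * T * W)))
        = A * (2 * W / m) * M ^ 2 * P * 1 * T := by ring
      _ ≤ A * (2 * W / m) * M ^ 2 * P * _ * T := by gcongr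
      _ = _ := rfl
  · intro x hx
    have hsq : (((σ x).re : ℝ) : ℂ) ^ 2 = (a x : ℂ) := by rw [← ha x hx]; push_cast; rfl
    have e1 : (sPlus σ x) ^ 2 = -(a x : ℂ) := by
      rw [sPlus, mul_pow, Complex.I_sq, hσim x hx, hsq]; ring
    have e2 : (sMinus σ x) ^ 2 = -(a x : ℂ) := by
      rw [sMinus, mul_pow, neg_sq, Complex.I_sq, hσim x hx, hsq]; ring
    have hrp' := hrp x hx
    have hrm' := hrm x hx
    rw [e1] at hrp'
    rw [e2] at hrm'
    have hw1 := hwp x hx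
    have hw2 := hwm x hx
    have ho := hode x hx
    simp only [Pi.sub_apply, Pi.add_apply]
    rw [hsq]
    set up := dSum (sPlus σ) N ε x
    set um := dSum (sMinus σ) N ε x
    set dp := ∑ n ∈ Finset.range (N + 1), (ε : ℂ) ^ n * deriv (dS (sPlus σ) n) x
    set dm := ∑ n ∈ Finset.range (N + 1), (ε : ℂ) ^ n * deriv (dS (sMinus σ) n) x
    set wp := expSum (sPlus σ) ξ N ε x
    set wm := expSum (sMinus σ) ξ N ε x
    -- After inserting the equation for `φ`, only the two residuals multiplied by their exponentials
    -- are left.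
    calc _ = ‖-(α * ((um ^ 2 + ε * dm - -(a x : ℂ)) * wm) +
          β * ((up ^ 2 + ε * dp - -(a x : ℂ)) * wp))‖ := by
          congr 1
          field_simp
          linear_combination ho
      _ ≤ P / m * (ε * (M ^ 2 * T) * W) + P / m * (ε * (M ^ 2 * T) * W) := by
          rw [norm_neg]
          refine (norm_add_le _ _).trans ?_
          simp only [norm_mul α, norm_mul β, norm_mul _ wm, norm_mul _ wp]
          gcongr
      _ = _ := by rw [abs_of_pos hε]; ring
  · simp [expSum_left, hi0, hsum]
  · have h1 : dφ ξ = (ε : ℂ)⁻¹ * φ₁ := by rw [← hi1]; field_simp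
    simp only [expSum_left, h1]
    linear_combination -(ε : ℂ)⁻¹ * hsum'

/-! ### Order in `ε` and choice of the thresholds. -/

theorem errorBound_isBigO (C L M K : ℝ) (N : ℕ) (p q : ℝ) :
    Asymptotics.IsBigO (nhdsWithin (0 : ℝ) (Set.Ioi 0))
      (fun ε => errorBound C L M K N ε p q) (fun ε => ε ^ N) := by
  set g : ℝ → ℝ := fun ε => C * M ^ 2 *
    (p * M * (∑ n ∈ Finset.range (N + 1), ε ^ n * K ^ n * (n : ℝ) ^ n) + q) *
    Real.exp (L * M * ∑ n ∈ Finset.range (N / 2 + 1),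
      ε ^ (2 * n) * K ^ (2 * n + 1) * ((2 * n + 1 : ℕ) : ℝ) ^ (2 * n + 1)) *
    (2 * K ^ (N + 1) * ((N + 1 : ℕ) : ℝ) ^ (N + 1) +
      ∑ n ∈ Finset.Icc 2 N, ε ^ (n - 1) * K ^ (N + n) *
        ∑ k ∈ Finset.Icc 2 (N + n),
          (k : ℝ) ^ k * ((N + n - k : ℕ) : ℝ) ^ (N + n - k)) with hg
  have hcont : Continuous g := by fun_prop
  have heq : (fun ε => errorBound C L M K N ε p q) = fun ε => g ε * ε ^ N := by
    funext ε
    have : ∑ n ∈ Finset.Icc 2 N, ε ^ (N + n - 1) * K ^ (N + n) *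
        ∑ k ∈ Finset.Icc 2 (N + n), (k : ℝ) ^ k * ((N + n - k : ℕ) : ℝ) ^ (N + n - k) =
        ε ^ N * ∑ n ∈ Finset.Icc 2 N, ε ^ (n - 1) * K ^ (N + n) *
        ∑ k ∈ Finset.Icc 2 (N + n), (k : ℝ) ^ k * ((N + n - k : ℕ) : ℝ) ^ (N + n - k) := by
      rw [Finset.mul_sum]
      refine Finset.sum_congr rfl fun n hn => ?_
      rw [Finset.mem_Icc] at hn
      rw [Nat.add_sub_assoc (by omega), pow_add]
      ring
    simp only [errorBound, hg, this]
    ring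
  rw [heq]
  have h1 : Asymptotics.IsBigO (nhdsWithin (0 : ℝ) (Set.Ioi 0)) g (fun _ => (1 : ℝ)) :=
    ((hcont.tendsto 0).mono_left nhdsWithin_le_nhds).isBigO_one ℝ
  simpa using h1.mul (Asymptotics.isBigO_refl (fun ε : ℝ => ε ^ N) _)

theorem exists_errorBound {ξ η m M K₁ K₂ : ℝ} (hξη : ξ < η) (hm : 0 < m) (hM : 0 < M)
    {a : ℝ → ℝ} {σ : ℂ → ℂ} {U : Set ℂ} (hU : IsOpen U) (hσ : DifferentiableOn ℂ σ U)
    (h0 : ∀ z ∈ U, σ z ≠ 0) (hIU : ∀ x ∈ Set.Icc ξ η, (x : ℂ) ∈ U)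
    (hσim : ∀ x ∈ Set.Icc ξ η, σ x = ((σ x).re : ℂ))
    (hσm : ∀ x ∈ Set.Icc ξ η, m ≤ (σ x).re) (ha : ∀ x ∈ Set.Icc ξ η, (σ x).re ^ 2 = a x)
    (hK : AdmissibleConstants σ ξ η M K₁ K₂) :
    ∃ C : ℝ, 0 < C ∧ ∃ ε₀ : ℕ → ℝ, (∀ N : ℕ, 0 < ε₀ N ∧ ε₀ N < 1) ∧
      (∃ c : ℝ, 0 < c ∧ ∀ N : ℕ, c / (N + 1) ≤ ε₀ N) ∧
      ∀ N : ℕ, ∀ ε : ℝ, 0 < ε → ε ≤ ε₀ N → denom σ ξ N ε ≠ 0 ∧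
        ∀ (φ₀ φ₁ : ℂ) (φ : ℝ → ℂ), IsSolution a ξ η ε φ₀ φ₁ φ →
          LInf (Set.Icc ξ η) (fun x => φ x - approx σ ξ N ε φ₀ φ₁ x) ≤
            ENNReal.ofReal (errorBound C (η - ξ) M K₂ N ε ‖φ₀‖ ‖φ₁‖) := by
  have hdc : ContinuousOn (fun x : ℝ => deriv σ x) (Set.Icc ξ η) :=
    (hσ.deriv hU).continuousOn.comp Complex.continuous_ofReal.continuousOn hIU
  obtain ⟨D, hD⟩ := isCompact_Icc.exists_bound_of_continuousOn hdc
  have hD0 : 0 ≤ D := (norm_nonneg _).trans (hD ξ ⟨le_rfl, hξη.le⟩)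
  have hK₂ : 0 < K₂ := hK.2.1
  have hL : 0 < η - ξ := sub_pos.2 hξη
  -- The entry `1 / 2` forces `ε₀ N < 1`; the other one gives both smallness conditions on `ε K₂ (N
  -- + 1)` when `ε ≤ c / (N + 1)`.
  set c := min (1 / 2) (min (1 / 4) (m / (4 * M)) / K₂) with hc
  have hc0 : 0 < c := by positivity
  have hc1 : c ≤ 1 / 2 := min_le_left _ _
  have hc2 : c * K₂ ≤ min (1 / 4) (m / (4 * M)) :=
    (le_div_iff₀ hK₂).1 (min_le_right _ _)
  refine ⟨Real.sqrt (Real.exp ((1 + 2 * D / m) * (η - ξ)) * (η - ξ)) / m *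
    (2 * Real.exp ((η - ξ) * M * (2 * K₂)) / m), by positivity, fun N => c / (N + 1),
    fun N => ⟨by positivity, ?_⟩, ⟨c, hc0, fun N => le_rfl⟩, fun N ε hε hεN => ?_⟩
  · have : (0 : ℝ) ≤ N := N.cast_nonneg
    rw [div_lt_one (by positivity)]
    linarith
  · have hq : ε * K₂ * (N + 1) ≤ min (1 / 4) (m / (4 * M)) := by
      refine le_trans ?_ hc2
      have := (le_div_iff₀ (by positivity : (0 : ℝ) < N + 1)).1 hεN
      nlinarith
    have h := norm_sub_approx_le hξη hm hM hU hσ h0 hIU hσim hσm ha hD0 hD hK hε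
      (hq.trans (min_le_left _ _)) (hq.trans (min_le_right _ _))
    exact ⟨h.1, fun φ₀ φ₁ φ hφ => LInf_Icc_le (h.2 φ₀ φ₁ φ hφ)⟩

end WKB

/-! ### The theorem. -/

theorem theorem2
    (ξ η : ℝ) (hξη : ξ < η)
    (a : ℝ → ℝ) (a₀ : ℝ) (ha₀ : 0 < a₀) (ha : ∀ x ∈ Set.Icc ξ η, a₀ ≤ a x)
    -- `G` is a complex neighbourhood of `I = [ξ, η]`
    (G : Set ℂ) (hG : IsOpen G) (hIG : ∀ x ∈ Set.Icc ξ η, (x : ℂ) ∈ G)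
    -- `σ` is a bounded analytic extension of `√a` to `G`, so that `S_0' = ± i σ`
    (σ : ℂ → ℂ) (hσ : AnalyticOnNhd ℂ σ G) (hσb : Bornology.IsBounded (σ '' G))
    (hσa : ∀ x ∈ Set.Icc ξ η, σ (x : ℂ) = (Real.sqrt (a x) : ℂ))
    (M : ℝ) (hM : M = (WKB.LInf G (WKB.sPlus σ)).toReal) :
    (∃ K₁ K₂ : ℝ, WKB.AdmissibleConstants σ ξ η M K₁ K₂) ∧
    (∀ K₁ K₂ : ℝ, WKB.AdmissibleConstants σ ξ η M K₁ K₂ →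
      -- `C` is independent of `N`; `ε₀` may depend on `N`, but decays at most like `1 / (N + 1)`
      ∃ C : ℝ, 0 < C ∧ ∃ ε₀ : ℕ → ℝ,
        (∀ N : ℕ, 0 < ε₀ N ∧ ε₀ N < 1) ∧
        (∃ c : ℝ, 0 < c ∧ ∀ N : ℕ, c / (N + 1) ≤ ε₀ N) ∧
        ∀ N : ℕ, ∀ ε : ℝ, 0 < ε → ε ≤ ε₀ N →
          -- the coefficients `α`, `β` are well defined
          WKB.denom σ ξ N ε ≠ 0 ∧
          ∀ (φ₀ φ₁ : ℂ) (φ : ℝ → ℂ), WKB.IsSolution a ξ η ε φ₀ φ₁ φ →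
            WKB.LInf (Set.Icc ξ η) (fun x => φ x - WKB.approx σ ξ N ε φ₀ φ₁ x) ≤
              ENNReal.ofReal (WKB.errorBound C (η - ξ) M K₂ N ε ‖φ₀‖ ‖φ₁‖)) ∧
    -- in particular, the error is `O(ε ^ N)` for each fixed `N`
    (∀ (φ₀ φ₁ : ℂ) (φ : ℝ → ℝ → ℂ),
      (∀ ε : ℝ, 0 < ε → ε < 1 → WKB.IsSolution a ξ η ε φ₀ φ₁ (φ ε)) →
      ∀ N : ℕ,
        Asymptotics.IsBigO (nhdsWithin (0 : ℝ) (Set.Ioi 0))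
          (fun ε : ℝ =>
            (WKB.LInf (Set.Icc ξ η)
              (fun x => φ ε x - WKB.approx σ ξ N ε φ₀ φ₁ x)).toReal)
          (fun ε : ℝ => ε ^ N)) := by
  have hm : 0 < Real.sqrt a₀ := Real.sqrt_pos.2 ha₀
  have hσd : DifferentiableOn ℂ σ G := hσ.differentiableOn
  have hσim : ∀ x ∈ Set.Icc ξ η, σ x = ((σ x).re : ℂ) := fun x hx => by
    rw [hσa x hx, Complex.ofReal_re]
  have hσm : ∀ x ∈ Set.Icc ξ η, Real.sqrt a₀ ≤ (σ x).re := fun x hx => by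
    rw [hσa x hx, Complex.ofReal_re]
    exact Real.sqrt_le_sqrt (ha x hx)
  have hσm' : ∀ x ∈ Set.Icc ξ η, Real.sqrt a₀ ≤ ‖σ x‖ := fun x hx =>
    (hσm x hx).trans (Complex.re_le_norm _)
  have hσsq : ∀ x ∈ Set.Icc ξ η, (σ x).re ^ 2 = a x := fun x hx => by
    rw [hσa x hx, Complex.ofReal_re, Real.sq_sqrt (ha₀.le.trans (ha x hx))]
  have hσM : ∀ z ∈ G, ‖σ z‖ ≤ M := fun z hz => by
    have hb : Bornology.IsBounded (WKB.sPlus σ '' G) := by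
      obtain ⟨B, hB⟩ := hσb.exists_norm_le
      refine isBounded_iff_forall_norm_le.2 ⟨B, ?_⟩
      rintro _ ⟨w, hw, rfl⟩
      simpa [WKB.sPlus] using hB _ ⟨w, hw, rfl⟩
    have h : ‖Complex.I * σ z‖ ≤ (WKB.LInf G (WKB.sPlus σ)).toReal :=
      WKB.norm_le_toReal_LInf hG (hσd.const_mul Complex.I).continuousOn hb hz
    rwa [norm_mul, Complex.norm_I, one_mul, ← hM] at h
  have hM0 : 0 < M := by
    have hξ : ξ ∈ Set.Icc ξ η := ⟨le_rfl, hξη.le⟩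
    exact hm.trans_le ((hσm' ξ hξ).trans (hσM _ (hIG ξ hξ)))
  have hex := WKB.exists_admissibleConstants hξη hm hG hIG hσd hσm' hσM
  -- The extension `σ` may vanish in `G` off the interval, so the neighbourhood is cut down to where
  -- `σ ≠ 0`, which still contains the interval.
  have hmain := fun K₁ K₂ hK => WKB.exists_errorBound (K₁ := K₁) (K₂ := K₂) (a := a) hξη hm hM0
    (hσd.continuousOn.isOpen_inter_preimage hG isOpen_compl_singleton)
    (hσd.mono Set.inter_subset_left) (fun z hz => hz.2)
    (fun x hx => ⟨hIG x hx, norm_pos_iff.1 (hm.trans_le (hσm' x hx))⟩) hσim hσm hσsq hK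
  refine ⟨hex, hmain, fun φ₀ φ₁ φ hφ N => ?_⟩
  obtain ⟨K₁, K₂, hK⟩ := hex
  obtain ⟨C, hC, ε₀, hε₀, -, hest⟩ := hmain K₁ K₂ hK
  refine Asymptotics.IsBigO.trans (Asymptotics.IsBigO.of_bound 1 ?_)
    (WKB.errorBound_isBigO C (η - ξ) M K₂ N ‖φ₀‖ ‖φ₁‖)
  filter_upwards [Ioc_mem_nhdsGT (hε₀ N).1] with ε hε
  have h := (hest N ε hε.1 hε.2).2 φ₀ φ₁ (φ ε) (hφ ε hε.1 (hε.2.trans_lt (hε₀ N).2))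
  have h1 := ENNReal.toReal_mono ENNReal.ofReal_ne_top h
  rw [Real.norm_of_nonneg ENNReal.toReal_nonneg, one_mul]
  refine h1.trans ?_
  rw [ENNReal.toReal_ofReal']
  exact max_le (le_abs_self _) (norm_nonneg _)
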